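/- Every planar lattice has breadth at most $2$. Here a lattice $L$ is \emph{planar} if it is finite and has a planar diagram: its elements can be represented by distinct points of the plane such that $a<b$ implies that the point of $a$ lies strictly lower than the point of $b$, and such that, when for each covering pair $a\prec b$ the straight line segment (edge) joining the points of $a$ and $b$ is drawn, no edge contains the point of an element other than its two endpoints, and any two distinct edges intersect only in common endpoints. The \emph{breadth} of a lattice $L$ is the least integer $n\ge 0$ such that any join $\bigvee_{i=1}^m x_i$ with $x_i\in L$ and $m\geq n$ is a join of $n$ of the joinands $x_i$ (where the empty join is the least element, so that only a singleton lattice has breadth $0$); it is $\infty$ if there is no such $n$. -/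

import Mathlib

/-- A planar diagram of an ordered set: each element is drawn as a point of the plane, larger
elements are drawn higher, each covering pair `a ⋖ b` is drawn as the straight line segment from
the point of `a` to the point of `b`, no edge passes through the point of an element other than
its endpoints, and two different edges meet only in common endpoints. The second coordinate is
the height. -/
structure IsPlanarDiagram {P : Type*} [PartialOrder P] (pos : P → ℝ × ℝ) : Prop where
  injective : Function.Injective pos
  upward : ∀ a b : P, a < b → (pos a).2 < (pos b).2
  vertex_not_on_edge : ∀ a b c : P, a ⋖ b → pos c ∈ segment ℝ (pos a) (pos b) → c = a ∨ c = b
  edges_not_crossing : ∀ a b c d : P, a ⋖ b → c ⋖ d → (a, b) ≠ (c, d) →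
    ∀ p : ℝ × ℝ, p ∈ segment ℝ (pos a) (pos b) → p ∈ segment ℝ (pos c) (pos d) →
      ∃ v : P, (v = a ∨ v = b) ∧ (v = c ∨ v = d) ∧ p = pos v

/-- An ordered set is planar if it is finite and has a planar diagram. -/
def IsPlanarOrder (P : Type*) [PartialOrder P] : Prop :=
  Finite P ∧ ∃ pos : P → ℝ × ℝ, IsPlanarDiagram pos

/-- Any join of `m ≥ n` elements is already the join of `n` of the joinands. Joins are taken as
least upper bounds, so that the empty join is the least element. -/
def JoinsReduceTo (L : Type*) [Lattice L] (n : ℕ) : Prop :=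
  ∀ (m : ℕ) (x : Fin m → L), n ≤ m → ∀ y : L, IsLUB (Set.range x) y →
    ∃ s : Finset (Fin m), s.card = n ∧ IsLUB (x '' (s : Set (Fin m))) y

/-- The breadth of a lattice: the least `n` such that any join of at least `n` elements is a join
of `n` of the joinands (`⊤` if there is no such `n`, and `0` for the singleton lattice). -/
noncomputable def latticeBreadth (L : Type*) [Lattice L] : ℕ∞ :=
  sInf {k : ℕ∞ | ∃ n : ℕ, k = (n : ℕ∞) ∧ JoinsReduceTo L n}

/-! For each `b`, a chain of edges from `⊥` to `⊤` through `b` is the graph of a continuous function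
of height, and splits the diagram into a left and a right side. Two such curves that swap sides meet
by the intermediate value theorem; planarity makes them meet at a vertex or along a common edge,
which yields comparabilities. For incomparable `a`, `b` this shows that `a` is left of `b` iff `b`
is right of `a` (`not_same_side`). An element with `x` and `z` on opposite sides is below `x ⊔ z`
(`le_of_crossing`). Among three elements, none below the join of the others, nobody may lie between
the other two, which contradicts antisymmetry of left and right. Hence any join can be thinned out
to two joinands. -/

/-- A continuous curve `f`, parametrized by height, that runs inside the diagram `pos` over the
heights between `u` and `v`, starts at the point of `u`, ends at the point of `v`, and follows
only (possibly degenerate) edges satisfying `E`. -/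
structure IsStrand {P : Type*} [PartialOrder P] (pos : P → ℝ × ℝ) (E : P → P → Prop) (u v : P)
    (f : ℝ → ℝ) : Prop where
  continuous : Continuous f
  left : f (pos u).2 = (pos u).1
  right : f (pos v).2 = (pos v).1
  edge : ∀ y ∈ Set.Icc (pos u).2 (pos v).2, ∃ c d : P, c ⩿ d ∧ E c d ∧
    (f y, y) ∈ segment ℝ (pos c) (pos d)

/-! ### Building strands from edges -/

namespace IsStrand

variable {P : Type*} [PartialOrder P] {pos : P → ℝ × ℝ} {E E₁ E₂ : P → P → Prop} {u v w : P}
  {f g : ℝ → ℝ}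

theorem mono (hf : IsStrand pos E₁ u v f) (h : ∀ c d, E₁ c d → E₂ c d) :
    IsStrand pos E₂ u v f where
  continuous := hf.continuous
  left := hf.left
  right := hf.right
  edge y hy := by
    obtain ⟨c, d, hcd, he, hp⟩ := hf.edge y hy
    exact ⟨c, d, hcd, h c d he, hp⟩

theorem glue (hf : IsStrand pos E u v f) (hg : IsStrand pos E v w g)
    (huv : (pos u).2 ≤ (pos v).2) (hvw : (pos v).2 ≤ (pos w).2) :
    IsStrand pos E u w (fun y => if y ≤ (pos v).2 then f y else g y) where
  continuous := Continuous.if_le hf.continuous hg.continuous continuous_id continuous_const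
    (fun y hy => by
      have hy' : y = (pos v).2 := hy
      rw [hy', hf.right, hg.left])
  left := by simp [huv, hf.left]
  right := by
    by_cases h : (pos w).2 ≤ (pos v).2
    · have e : (pos w).2 = (pos v).2 := le_antisymm h hvw
      have := hg.right
      rw [e, hg.left] at this
      simp [e, hf.right, this]
    · simp [h, hg.right]
  edge y hy := by
    by_cases h : y ≤ (pos v).2
    · simpa [h] using hf.edge y ⟨hy.1, h⟩
    · simpa [h] using hg.edge y ⟨(not_le.1 h).le, hy.2⟩

theorem refl (u : P) (h : E u u) : IsStrand pos E u u (fun _ => (pos u).1) where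
  continuous := continuous_const
  left := rfl
  right := rfl
  edge y hy := by
    refine ⟨u, u, WCovBy.refl u, h, ?_⟩
    have : y = (pos u).2 := le_antisymm hy.2 hy.1
    simp [this]

theorem of_covBy (huv : u ⋖ v) (h : E u v) (hlt : (pos u).2 < (pos v).2) :
    IsStrand pos E u v (fun y => (pos u).1 +
      (y - (pos u).2) / ((pos v).2 - (pos u).2) * ((pos v).1 - (pos u).1)) where
  continuous := by fun_prop
  left := by simp
  right := by
    have : (pos v).2 - (pos u).2 ≠ 0 := by linarith
    simp [this]
  edge y hy := by
    refine ⟨u, v, huv.wcovBy, h, ?_⟩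
    have hpos : 0 < (pos v).2 - (pos u).2 := by linarith
    rw [segment_eq_image']
    refine ⟨(y - (pos u).2) / ((pos v).2 - (pos u).2),
      ⟨div_nonneg (by linarith [hy.1]) hpos.le, (div_le_one hpos).2 (by linarith [hy.2])⟩, ?_⟩
    ext
    · simp
    · simp [hpos.ne']

end IsStrand

namespace IsPlanarDiagram

variable {P : Type*} [PartialOrder P] {pos : P → ℝ × ℝ}

theorem height_le (h : IsPlanarDiagram pos) {a b : P} (hab : a ≤ b) : (pos a).2 ≤ (pos b).2 := by
  rcases hab.eq_or_lt with rfl | hlt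
  · rfl
  · exact (h.upward a b hlt).le

theorem eq_of_height_le (h : IsPlanarDiagram pos) {a b : P} (hab : a ≤ b)
    (hle : (pos b).2 ≤ (pos a).2) : a = b := by
  by_contra hne
  exact absurd (h.upward a b (lt_of_le_of_ne hab hne)) (not_lt.2 hle)

theorem height_mem_Icc (h : IsPlanarDiagram pos) {c d : P} (hcd : c ≤ d) {p : ℝ × ℝ}
    (hp : p ∈ segment ℝ (pos c) (pos d)) : p.2 ∈ Set.Icc (pos c).2 (pos d).2 := by
  rw [segment_eq_image'] at hp
  obtain ⟨t, ht, rfl⟩ := hp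
  have := h.height_le hcd
  simp only [Prod.snd_add, Prod.smul_snd, Prod.snd_sub, smul_eq_mul]
  constructor <;> nlinarith [ht.1, ht.2]

/-- Every interval of a finite diagram is joined by a strand inside the interval. -/
theorem exists_strand [Finite P] (h : IsPlanarDiagram pos) {a b : P} (hab : a ≤ b) :
    ∃ f, IsStrand pos (fun c d => a ≤ c ∧ d ≤ b) a b f := by
  induction b using WellFoundedLT.induction with
  | ind b ih =>
    rcases hab.eq_or_lt with rfl | hlt
    · exact ⟨_, IsStrand.refl a ⟨le_rfl, le_rfl⟩⟩
    · obtain ⟨c, hac, hcb⟩ := exists_le_covBy_of_lt hlt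
      obtain ⟨f, hf⟩ := ih c hcb.lt hac
      exact ⟨_, (hf.mono fun _ _ e => ⟨e.1, e.2.trans hcb.le⟩).glue
        (IsStrand.of_covBy hcb ⟨hac, le_rfl⟩ (h.upward _ _ hcb.lt))
        (h.height_le hac) (h.height_le hcb.le)⟩

/-- Through every element passes a strand from bottom to top all of whose vertices are comparable
with the element. -/
theorem exists_strand_through [Finite P] [BoundedOrder P] (h : IsPlanarDiagram pos) (b : P) :
    ∃ f, IsStrand pos (fun c d => d ≤ b ∨ b ≤ c) ⊥ ⊤ f ∧ f (pos b).2 = (pos b).1 := by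
  obtain ⟨f, hf⟩ := h.exists_strand (bot_le : ⊥ ≤ b)
  obtain ⟨g, hg⟩ := h.exists_strand (le_top : b ≤ ⊤)
  exact ⟨_, (hf.mono fun _ _ e => Or.inl e.2).glue (hg.mono fun _ _ e => Or.inr e.1)
    (h.height_le bot_le) (h.height_le le_top), by simp [hf.right]⟩

/-- Two (possibly degenerate) edges through a common point coincide or meet in a vertex. -/
theorem eq_or_meet (h : IsPlanarDiagram pos) {a b c d : P} (hab : a ⩿ b) (hcd : c ⩿ d)
    {p : ℝ × ℝ} (hp : p ∈ segment ℝ (pos a) (pos b)) (hq : p ∈ segment ℝ (pos c) (pos d)) :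
    (a = c ∧ b = d) ∨ ∃ v, (v = a ∨ v = b) ∧ (v = c ∨ v = d) ∧ p = pos v := by
  rcases wcovBy_iff_covBy_or_eq.1 hab with hab | rfl
  · rcases wcovBy_iff_covBy_or_eq.1 hcd with hcd | rfl
    · by_cases e : (a, b) = (c, d)
      · exact Or.inl (by simpa using e)
      · exact Or.inr (h.edges_not_crossing a b c d hab hcd e p hp hq)
    · have e : p = pos c := by simpa using hq
      exact Or.inr ⟨c, h.vertex_not_on_edge a b c hab (e ▸ hp), Or.inl rfl, e⟩
  · have e : p = pos a := by simpa using hp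
    rcases wcovBy_iff_covBy_or_eq.1 hcd with hcd | rfl
    · exact Or.inr ⟨a, Or.inl rfl, h.vertex_not_on_edge c d a hcd (e ▸ hq), e⟩
    · have e' : p = pos c := by simpa using hq
      have : a = c := h.injective (e.symm.trans e')
      exact Or.inl ⟨this, this⟩

/-! ### Crossing strands and comparability -/

/-- Two strands which change sides between the heights `s ≤ t` share a (possibly degenerate) edge
at some height in between. -/
theorem exists_common_edge (h : IsPlanarDiagram pos) {E F : P → P → Prop}
    (hE : ∀ c d v, c ≤ d → E c d → (v = c ∨ v = d) → E v v)
    (hF : ∀ c d v, c ≤ d → F c d → (v = c ∨ v = d) → F v v)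
    {u v u' v' : P} {f g : ℝ → ℝ} (hf : IsStrand pos E u v f) (hg : IsStrand pos F u' v' g)
    {s t : ℝ} (hst : s ≤ t) (hs : (pos u).2 ≤ s) (hs' : (pos u').2 ≤ s)
    (ht : t ≤ (pos v).2) (ht' : t ≤ (pos v').2)
    (hcross : (f s ≤ g s ∧ g t ≤ f t) ∨ (g s ≤ f s ∧ f t ≤ g t)) :
    ∃ y ∈ Set.Icc s t, ∃ c d : P, c ≤ d ∧ E c d ∧ F c d ∧ (pos c).2 ≤ y ∧ y ≤ (pos d).2 := by
  obtain ⟨y, hy, hfg⟩ : ∃ y ∈ Set.Icc s t, f y = g y := by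
    rcases hcross with ⟨h₁, h₂⟩ | ⟨h₁, h₂⟩
    · exact isPreconnected_Icc.intermediate_value₂ (Set.left_mem_Icc.2 hst)
        (Set.right_mem_Icc.2 hst) hf.continuous.continuousOn hg.continuous.continuousOn h₁ h₂
    · obtain ⟨y, hy, e⟩ := isPreconnected_Icc.intermediate_value₂ (Set.left_mem_Icc.2 hst)
        (Set.right_mem_Icc.2 hst) hg.continuous.continuousOn hf.continuous.continuousOn h₁ h₂
      exact ⟨y, hy, e.symm⟩
  obtain ⟨c, d, hcd, he, hp⟩ := hf.edge y ⟨hs.trans hy.1, hy.2.trans ht⟩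
  obtain ⟨c', d', hcd', he', hp'⟩ := hg.edge y ⟨hs'.trans hy.1, hy.2.trans ht'⟩
  rw [← hfg] at hp'
  refine ⟨y, hy, ?_⟩
  rcases h.eq_or_meet hcd hcd' hp hp' with ⟨rfl, rfl⟩ | ⟨w, hw, hw', e⟩
  · have := h.height_mem_Icc hcd.le hp
    exact ⟨c, d, hcd.le, he, he', this.1, this.2⟩
  -- A shared vertex counts as the degenerate edge from `w` to `w`; this is why `E` and `F` must
  -- pass to endpoints.
  · have e₂ : y = (pos w).2 := congrArg Prod.snd e
    exact ⟨w, w, le_rfl, hE c d w hcd.le he hw, hF c' d' w hcd'.le he' hw', e₂.ge, e₂.le⟩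

variable [BoundedOrder P]

/-- Two incomparable elements cannot lie on the same side of strands through each other. -/
theorem not_same_side (h : IsPlanarDiagram pos) {a b : P} (hab : ¬ a ≤ b) (hba : ¬ b ≤ a)
    {f g : ℝ → ℝ} (hf : IsStrand pos (fun c d => d ≤ a ∨ a ≤ c) ⊥ ⊤ f)
    (hg : IsStrand pos (fun c d => d ≤ b ∨ b ≤ c) ⊥ ⊤ g)
    (hcross : (f (pos a).2 ≤ g (pos a).2 ∧ g (pos b).2 ≤ f (pos b).2) ∨
      (g (pos a).2 ≤ f (pos a).2 ∧ f (pos b).2 ≤ g (pos b).2)) : False := by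
  wlog hle : (pos a).2 ≤ (pos b).2 generalizing a b f g
  · exact this hba hab hg hf (by tauto) (le_of_not_ge hle)
  have key : ∀ x c d v : P, c ≤ d → (d ≤ x ∨ x ≤ c) → (v = c ∨ v = d) → (v ≤ x ∨ x ≤ v) := by
    rintro x c d v hcd (hx | hx) (rfl | rfl)
    exacts [Or.inl (hcd.trans hx), Or.inl hx, Or.inr hx, Or.inr (hx.trans hcd)]
  obtain ⟨y, hy, c, d, hcd, hE, hF, hc, hd⟩ := h.exists_common_edge (key a) (key b) hf hg hle
    (h.height_le bot_le) (h.height_le bot_le) (h.height_le le_top) (h.height_le le_top) hcross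
  -- The meeting height lies between those of `a` and `b`, so a common edge ending below `a` must
  -- end at `a`, and one starting above `b` must start at `b`.
  rcases hE with hE | hE
  · have e : d = a := h.eq_of_height_le hE (hy.1.trans hd)
    subst e
    exact hF.elim hab fun hF => hba (hF.trans hcd)
  · rcases hF with hF | hF
    · exact hab ((hE.trans hcd).trans hF)
    · have e : b = c := h.eq_of_height_le hF (hc.trans hy.2)
      exact hab (e ▸ hE)

/-- If the interval from `c` to `s` changes sides of a strand through `b` and `c` is not below
`b`, then `b` is below `s`. -/
theorem le_of_crossing [Finite P] (h : IsPlanarDiagram pos) {b c s : P} (hcb : ¬ c ≤ b)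
    (hcs : c ≤ s) {g : ℝ → ℝ} (hg : IsStrand pos (fun c d => d ≤ b ∨ b ≤ c) ⊥ ⊤ g)
    (hcross : ((pos c).1 ≤ g (pos c).2 ∧ g (pos s).2 ≤ (pos s).1) ∨
      (g (pos c).2 ≤ (pos c).1 ∧ (pos s).1 ≤ g (pos s).2)) : b ≤ s := by
  obtain ⟨f, hf⟩ := h.exists_strand hcs
  rw [← hf.left, ← hf.right] at hcross
  obtain ⟨_, -, p, q, hpq, hE, hF, -⟩ := h.exists_common_edge
    (by
      rintro p q v hpq ⟨h₁, h₂⟩ (rfl | rfl)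
      exacts [⟨h₁, hpq.trans h₂⟩, ⟨h₁.trans hpq, h₂⟩])
    (by
      rintro p q v hpq (hx | hx) (rfl | rfl)
      exacts [Or.inl (hpq.trans hx), Or.inl hx, Or.inr hx, Or.inr (hx.trans hpq)])
    hf hg (h.height_le hcs) le_rfl (h.height_le bot_le) le_rfl (h.height_le le_top) hcross
  rcases hF with hF | hF
  · exact absurd ((hE.1.trans hpq).trans hF) hcb
  · exact (hF.trans hpq).trans hE.2

end IsPlanarDiagram

/-- Of three elements of a planar lattice, one is below the join of the other two. -/
theorem IsPlanarDiagram.le_sup_or {L : Type*} [Lattice L] [BoundedOrder L] [Finite L]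
    {pos : L → ℝ × ℝ} (h : IsPlanarDiagram pos) (a b c : L) :
    a ≤ b ⊔ c ∨ b ≤ a ⊔ c ∨ c ≤ a ⊔ b := by
  choose g hg hgx using h.exists_strand_through
  have side : ∀ x y : L, ¬ x ≤ y → ¬ y ≤ x →
      ¬ ((pos y).1 ≤ g x (pos y).2 ∧ (pos x).1 ≤ g y (pos x).2) ∧
      ¬ (g x (pos y).2 ≤ (pos y).1 ∧ g y (pos x).2 ≤ (pos x).1) := by
    intro x y hxy hyx
    have := h.not_same_side hxy hyx (hg x) (hg y)
    rw [hgx, hgx] at this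
    tauto
  have between : ∀ x y z : L, ¬ x ≤ y → ¬ z ≤ y → (pos x).1 ≤ g y (pos x).2 →
      g y (pos z).2 ≤ (pos z).1 → y ≤ x ⊔ z := by
    intro x y z hxy hzy hx hz
    -- Whichever side of the curve through `y` the join is on, the strand to it from `x` or `z` on
    -- the other side crosses that curve.
    rcases le_total (pos (x ⊔ z)).1 (g y (pos (x ⊔ z)).2) with hs | hs
    · exact h.le_of_crossing hzy le_sup_right (hg y) (Or.inr ⟨hz, hs⟩)
    · exact h.le_of_crossing hxy le_sup_left (hg y) (Or.inl ⟨hx, hs⟩)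
  by_contra! hcon
  obtain ⟨ha, hb, hc⟩ := hcon
  have hab : ¬ a ≤ b := fun e => ha (e.trans le_sup_left)
  have hac : ¬ a ≤ c := fun e => ha (e.trans le_sup_right)
  have hba : ¬ b ≤ a := fun e => hb (e.trans le_sup_left)
  have hbc : ¬ b ≤ c := fun e => hb (e.trans le_sup_right)
  have hca : ¬ c ≤ a := fun e => hc (e.trans le_sup_left)
  have hcb : ¬ c ≤ b := fun e => hc (e.trans le_sup_right)
  have s₁ := side a b hab hba
  have s₂ := side a c hac hca
  have s₃ := side b c hbc hcb
  have a₁ := fun p q => ha (between b a c hba hca p q)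
  have a₂ := fun p q => ha (sup_comm c b ▸ between c a b hca hba p q)
  have b₁ := fun p q => hb (between a b c hab hcb p q)
  have b₂ := fun p q => hb (sup_comm c a ▸ between c b a hcb hab p q)
  have c₁ := fun p q => hc (between a c b hac hbc p q)
  have c₂ := fun p q => hc (sup_comm b a ▸ between b c a hbc hac p q)
  -- If `b` is left of `a`, so is `c`, as `a` is not between them. Then `b` and `c` both have `a` on
  -- their right, hence each has the other on its right, which is impossible. The second case is the
  -- mirror image.
  rcases le_total (pos b).1 (g a (pos b).2) with t₁ | t₁
  · have t₂ := (le_total (pos c).1 (g a (pos c).2)).resolve_right fun t => a₁ t₁ t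
    have t₃ := (le_total (pos a).1 (g b (pos a).2)).resolve_left fun t => s₁.1 ⟨t₁, t⟩
    have t₄ := (le_total (pos c).1 (g b (pos c).2)).resolve_left fun t => b₂ t t₃
    have t₅ := (le_total (pos a).1 (g c (pos a).2)).resolve_left fun t => s₂.1 ⟨t₂, t⟩
    have t₆ := (le_total (pos b).1 (g c (pos b).2)).resolve_left fun t => c₂ t t₅
    exact s₃.2 ⟨t₄, t₆⟩
  · have t₂ := (le_total (pos c).1 (g a (pos c).2)).resolve_left fun t => a₂ t t₁
    have t₃ := (le_total (pos a).1 (g b (pos a).2)).resolve_right fun t => s₁.2 ⟨t₁, t⟩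
    have t₄ := (le_total (pos c).1 (g b (pos c).2)).resolve_right fun t => b₁ t₃ t
    have t₅ := (le_total (pos a).1 (g c (pos a).2)).resolve_right fun t => s₂.2 ⟨t₂, t⟩
    have t₆ := (le_total (pos b).1 (g c (pos b).2)).resolve_right fun t => c₁ t₅ t
    exact s₃.1 ⟨t₄, t₆⟩

/-! ### From three joinands to arbitrary joins -/

/-- If of any three elements one is below the join of the others, then joins reduce to two
joinands. -/
theorem joinsReduceTo_two {L : Type*} [Lattice L]
    (h : ∀ a b c : L, a ≤ b ⊔ c ∨ b ≤ a ⊔ c ∨ c ≤ a ⊔ b) : JoinsReduceTo L 2 := by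
  intro m x hm y hy
  -- Induction on the set of joinands: a new `j` joins the pair `p`, `q` already controlling `t`,
  -- and the redundant one of the three is dropped.
  have key : ∀ t : Finset (Fin m), 2 ≤ t.card → ∃ s ⊆ t, s.card = 2 ∧
      ∀ i ∈ t, ∀ u ∈ upperBounds (x '' (s : Set (Fin m))), x i ≤ u := by
    intro t
    induction t using Finset.induction_on with
    | empty => simp
    | insert j t hj ih =>
      intro hcard
      rw [Finset.card_insert_of_notMem hj] at hcard
      by_cases ht : 2 ≤ t.card
      · obtain ⟨s, hst, hs, hub⟩ := ih ht
        obtain ⟨p, q, hpq, rfl⟩ := Finset.card_eq_two.1 hs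
        have hp : p ∈ t := hst (by simp)
        have hq : q ∈ t := hst (by simp)
        have hjp : j ≠ p := fun e => hj (e ▸ hp)
        have hjq : j ≠ q := fun e => hj (e ▸ hq)
        have hub' : ∀ u, x p ≤ u → x q ≤ u → ∀ i ∈ t, x i ≤ u := fun u h₁ h₂ i hi =>
          hub i hi u (by
            rintro _ ⟨k, hk, rfl⟩
            rcases Finset.mem_insert.1 (Finset.mem_coe.1 hk) with rfl | hk
            · exact h₁
            · exact Finset.mem_singleton.1 hk ▸ h₂)
        rcases h (x p) (x q) (x j) with h₁ | h₁ | h₁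
        · refine ⟨{q, j}, by grind, Finset.card_pair hjq.symm, fun i hi u hu => ?_⟩
          have hu₁ : x q ≤ u := hu ⟨q, by simp, rfl⟩
          have hu₂ : x j ≤ u := hu ⟨j, by simp, rfl⟩
          rcases Finset.mem_insert.1 hi with rfl | hi
          · exact hu₂
          · exact hub' u (h₁.trans (sup_le hu₁ hu₂)) hu₁ i hi
        · refine ⟨{p, j}, by grind, Finset.card_pair hjp.symm, fun i hi u hu => ?_⟩
          have hu₁ : x p ≤ u := hu ⟨p, by simp, rfl⟩
          have hu₂ : x j ≤ u := hu ⟨j, by simp, rfl⟩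
          rcases Finset.mem_insert.1 hi with rfl | hi
          · exact hu₂
          · exact hub' u hu₁ (h₁.trans (sup_le hu₁ hu₂)) i hi
        · refine ⟨{p, q}, by grind, hs, fun i hi u hu => ?_⟩
          have hu₁ : x p ≤ u := hu ⟨p, by simp, rfl⟩
          have hu₂ : x q ≤ u := hu ⟨q, by simp, rfl⟩
          rcases Finset.mem_insert.1 hi with rfl | hi
          · exact h₁.trans (sup_le hu₁ hu₂)
          · exact hub' u hu₁ hu₂ i hi
      -- Here `t` is a singleton, so `insert j t` is itself the pair.
      · refine ⟨insert j t, subset_rfl, ?_, fun i hi u hu => hu ⟨i, by simpa using hi, rfl⟩⟩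
        rw [Finset.card_insert_of_notMem hj]
        omega
  obtain ⟨s, -, hs, hub⟩ := key Finset.univ (by simpa using hm)
  refine ⟨s, hs, ?_, fun u hu => hy.2 ?_⟩
  · rintro _ ⟨i, -, rfl⟩
    exact hy.1 ⟨i, rfl⟩
  · rintro _ ⟨i, rfl⟩
    exact hub i (Finset.mem_univ i) u hu

theorem mainTheorem6 (L : Type*) [Lattice L] (hL : IsPlanarOrder L) :
    latticeBreadth L ≤ 2 := by
  obtain ⟨hfin, pos, hpos⟩ := hL
  refine sInf_le ⟨2, rfl, joinsReduceTo_two fun a b c => ?_⟩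
  have : Nonempty L := ⟨a⟩
  let _ := Fintype.ofFinite L
  let _ := Fintype.toBoundedOrder L
  exact hpos.le_sup_or a b c
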